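/- Let $K$ be a number field and let $U:\mathbb Z\to K$ be a linear recurrence sequence (LRS), satisfying $$U(n+m)=a_{m-1}U(n+m-1)+\cdots+a_0U(n)\qquad(n\in\mathbb Z)$$ with $m\ge 1$, $a_0,\dots,a_{m-1}\in K$ and $a_0\neq 0$. Let $a\in\mathbb Z$ be a zero of $U$, that is, $U(a)=0$. Assume that $U$ is non-degenerate or, more generally, that $U$ does not vanish identically on any residue class $\{n\in\mathbb Z: n\equiv a \pmod N\}$, $N\ge 1$. (Here $U$ is called non-degenerate if it is not identically zero and no quotient of two distinct roots of the characteristic polynomial of the recurrence relation of minimal order satisfied by $U$ is a root of unity.) Let $\mathfrak p$ be a prime of $K$ that is regular for $U$, meaning that $a_0,\dots,a_{m-1}$ are $\mathfrak p$-adic integers and $a_0$ is a $\mathfrak p$-adic unit, and let $p$ be the rational prime below $\mathfrak p$. Denote by $\nu_{\mathfrak p}$ the $\mathfrak p$-adic valuation on $K$ normalized by $\nu_{\mathfrak p}(K^\times)=\mathbb Z$, and by $\nu_p$ the usual $p$-adic valuation on $\mathbb Z$, with $\nu_{\mathfrak p}(0)=\nu_p(0)=+\infty$. Then there exist a positive integer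 $Q$, a positive integer $\kappa$ and an integer $\tau$ such that $$\nu_{\mathfrak p}(U(n))=\kappa\,\nu_p(n-a)+\tau\qquad\text{for all integers } n\equiv a\pmod Q .$$ -/

import Mathlib

open scoped NumberField
open IsDedekindDomain

/-- The two-sided sequence `U : ℤ → K` satisfies the recurrence `E` of positive order `m`,
`U(n+m) = a_{m-1} U(n+m-1) + ⋯ + a_0 U(n)` for all `n : ℤ`, and `a_0 ≠ 0`.
An LRS over `K` is a sequence `U` for which such an `E` exists. -/
def IsLRSWith {K : Type*} [Field K] (E : LinearRecurrence K) (U : ℤ → K) : Prop :=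
  (∃ h : 0 < E.order, E.coeffs ⟨0, h⟩ ≠ 0) ∧
    ∀ n : ℤ, U (n + (E.order : ℤ)) = ∑ i : Fin E.order, E.coeffs i * U (n + ((i : ℕ) : ℤ))

/-- `E` is a recurrence relation of minimal order satisfied by `U`. -/
def IsMinimalLRSWith {K : Type*} [Field K] (E : LinearRecurrence K) (U : ℤ → K) : Prop :=
  IsLRSWith E U ∧ ∀ E' : LinearRecurrence K, IsLRSWith E' U → E.order ≤ E'.order

/-- A non-zero LRS is non-degenerate if no quotient of two distinct roots (in an algebraic closure)
of the characteristic polynomial of its minimal recurrence relation is a root of unity. -/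
def IsNonDegenerateLRS {K : Type*} [Field K] (U : ℤ → K) : Prop :=
  U ≠ 0 ∧ ∃ E : LinearRecurrence K, IsMinimalLRSWith E U ∧
    ∀ x y : AlgebraicClosure K,
      Polynomial.aeval x E.charPoly = 0 → Polynomial.aeval y E.charPoly = 0 → x ≠ y →
        ∀ k : ℕ, 0 < k → (x / y) ^ k ≠ 1

/-- The prime `P` is regular for the recurrence relation `E`: all coefficients are `P`-adic integers
and `a_0` is a `P`-adic unit. -/
def IsRegularPrime {K : Type*} [Field K] [NumberField K] (P : HeightOneSpectrum (𝓞 K))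
    (E : LinearRecurrence K) : Prop :=
  (∀ i : Fin E.order, P.valuation K (E.coeffs i) ≤ 1) ∧
    ∃ h : 0 < E.order, P.valuation K (E.coeffs ⟨0, h⟩) = 1

/-- The additive `P`-adic valuation of `K`, normalized to have value group `ℤ`, with
`ν_P(0) = +∞`. -/
noncomputable def primeOrd {K : Type*} [Field K] [NumberField K] (P : HeightOneSpectrum (𝓞 K))
    (x : K) : WithTop ℤ :=
  open Classical in
  if x = 0 then ⊤ else ((-(WithZero.log (P.valuation K x)) : ℤ) : WithTop ℤ)

/-- The `p`-adic order of an integer, with `ν_p(0) = +∞`. -/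
def padicOrd (p : ℕ) (z : ℤ) : WithTop ℤ :=
  if z = 0 then ⊤ else (((padicValInt p z : ℕ) : ℤ) : WithTop ℤ)

/-! The values of `U` along a suitable progression through `a` are interpolated by a `𝔭`-adic
analytic function, and the order of its zero at `0` governs the valuations. At a regular prime the
indeterminate is a unit modulo the characteristic polynomial, hence has finite order modulo `p ^ 2`.
So for some step `h` the difference operator is divisible by `p ^ 2` on `U`, and the `j`-th
differences are `O(p ^ (2 * j))` (`IsRegularPrime.exists_valuation_fwdDiff_iter_le`). Since `j!`
divides `p ^ j` in the local ring, the Newton series of `t ↦ U (a + t * h)` rearranges into a power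
series in `t` (`exists_analyticAt_eq_of_norm_fwdDiff_iter_le`). This function is not locally zero,
as `U` vanishes on no residue class of `a`. It is therefore `z ^ s * g z` with `g 0 ≠ 0`, and `s >
0` because `U a = 0`. Near `0` the norm of `g` is constant, so for `t ∈ p ^ r ℤ` only `|t| ^ s`
varies (`exists_norm_eq_norm_pow_mul`). Thus `κ` is `s` times the ramification index. Non-degeneracy
gives non-vanishing on residue classes: modulo the characteristic polynomial, `X` is a polynomial in
`X ^ N`, so zeros on one class spread to the next. -/

/-! ### Recovering the indeterminate from its `N`-th power. -/

open Polynomial in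
/-- If distinct roots of `f` have distinct `N`-th powers and `f(0) ≠ 0`, then modulo `f` the indeterminate is a polynomial in its `N`-th power. -/
theorem Polynomial.exists_dvd_comp_X_pow_sub_X {F : Type*} [Field F] [IsAlgClosed F] [CharZero F]
    {f : F[X]} (hf : f ≠ 0) (h0 : f.eval 0 ≠ 0) {N : ℕ} (hN : 0 < N)
    (hinj : ∀ x y : F, f.IsRoot x → f.IsRoot y → x ^ N = y ^ N → x = y) :
    ∃ q : F[X], f ∣ q.comp (X ^ N) - X := by
  classical
  have hroot : ∀ x, x ∈ f.roots.toFinset ↔ f.IsRoot x := by simp [hf]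
  have hinj' : Set.InjOn (fun x : F => x ^ N) (f.roots.toFinset : Set F) := by
    intro x hx y hy hxy
    exact hinj x y ((hroot x).1 hx) ((hroot y).1 hy) hxy
  -- A polynomial vanishing at all roots of `f` is nilpotent modulo `f`.
  have hnil : ∀ g : F[X], (∀ x, f.IsRoot x → g.eval x = 0) → IsNilpotent (AdjoinRoot.mk f g) := by
    intro g hg
    refine ⟨f.roots.card, ?_⟩
    rw [← map_pow, AdjoinRoot.mk_eq_zero]
    have hs := (IsAlgClosed.splits f).eq_prod_roots
    rw [hs, (isUnit_C.2 (isUnit_iff_ne_zero.2 (leadingCoeff_ne_zero.2 hf))).mul_left_dvd, ← hs]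
    have := Multiset.prod_dvd_prod_of_dvd (S := f.roots) (fun a => X - C a) (fun _ => g)
      (fun a ha => dvd_iff_isRoot.2 (hg a ((mem_roots hf).1 ha)))
    simpa using this
  set T : AdjoinRoot f := AdjoinRoot.root f with hT
  have hmk : ∀ q : F[X], AdjoinRoot.mk f (q.comp (X ^ N)) = aeval (T ^ N) q := by
    intro q
    rw [← AdjoinRoot.aeval_eq, aeval_comp]
    simp [hT]
  let B : Subalgebra F (AdjoinRoot f) := Algebra.adjoin F {T ^ N}
  have hTB : T ^ N ∈ B := Algebra.subset_adjoin rfl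
  have hmem : ∀ q : F[X], aeval (T ^ N) q ∈ B := fun q => aeval_mem_adjoin_singleton F _
  -- Interpolation on the `N`-th powers of the roots gives elements of `B` equal to `T` and `T⁻¹` up
  -- to nilpotents.
  set q₀ := Lagrange.interpolate f.roots.toFinset (fun x => x ^ N) (fun x => x)
  set q₁ := Lagrange.interpolate f.roots.toFinset (fun x => x ^ N) (fun x => x⁻¹)
  let t : B := ⟨T ^ N, hTB⟩
  let x₀ : B := ⟨aeval (T ^ N) q₀, hmem q₀⟩
  let x₁ : B := ⟨aeval (T ^ N) q₁, hmem q₁⟩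
  have e₀ : ∀ x, f.IsRoot x → q₀.eval (x ^ N) = x := fun x hx =>
    Lagrange.eval_interpolate_at_node (fun x : F => x) hinj' ((hroot x).2 hx)
  have e₁ : ∀ x, f.IsRoot x → q₁.eval (x ^ N) = x⁻¹ := fun x hx =>
    Lagrange.eval_interpolate_at_node (fun x : F => x⁻¹) hinj' ((hroot x).2 hx)
  have hBnil : ∀ b : B, IsNilpotent (b : AdjoinRoot f) → IsNilpotent b := by
    rintro b ⟨k, hk⟩
    exact ⟨k, Subtype.ext (by simpa using hk)⟩
  have n₀ : IsNilpotent ((x₀ : AdjoinRoot f) - T) := by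
    have := hnil (q₀.comp (X ^ N) - X) (fun x hx => by simp [e₀ x hx])
    rwa [map_sub, hmk, AdjoinRoot.mk_X] at this
  have hx₀ : IsUnit x₀ := by
    have h1 : IsNilpotent (x₀ * x₁ - 1) := by
      apply hBnil
      have := hnil (q₀.comp (X ^ N) * q₁.comp (X ^ N) - 1) (fun x hx => by
        have hx0 : x ≠ 0 := by rintro rfl; exact h0 hx
        simp [e₀ x hx, e₁ x hx, hx0])
      rw [map_sub, map_mul, hmk, hmk, map_one] at this
      simpa [x₀, x₁] using this
    have h2 := h1.isUnit_one_add
    rw [add_sub_cancel] at h2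
    exact isUnit_of_mul_isUnit_left h2
  -- Newton lifting: `x₀` is a root of `P` up to a nilpotent, with unit derivative, so it lifts to a
  -- root in `B`. Uniqueness of the lift in the whole of `AdjoinRoot f` identifies that root with
  -- `T`.
  let P : B[X] := X ^ N - C t
  have hP : ∀ y : AdjoinRoot f, aeval y P = y ^ N - T ^ N := by
    intro y; simp [P, t]
  have hPB : IsNilpotent (aeval x₀ P) := by
    apply hBnil
    have : ((aeval x₀ P : B) : AdjoinRoot f) = (x₀ : AdjoinRoot f) ^ N - T ^ N := by
      simp [P, t]
    rw [this]
    obtain ⟨c, hc⟩ := sub_dvd_pow_sub_pow (x₀ : AdjoinRoot f) T N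
    rw [hc]
    exact (Commute.all _ _).isNilpotent_mul_right n₀
  have hPB' : IsUnit (aeval x₀ (derivative P)) := by
    have hNu : IsUnit ((N : ℕ) : B) := by
      have : ((N : ℕ) : B) = algebraMap F B N := by simp
      rw [this]
      exact (isUnit_iff_ne_zero.2 (Nat.cast_ne_zero.2 hN.ne')).map _
    have : aeval x₀ (derivative P) = (N : B) * x₀ ^ (N - 1) := by
      simp [P, derivative_X_pow]
    rw [this]
    exact hNu.mul (hx₀.pow _)
  obtain ⟨r, ⟨hr1, hr2⟩, -⟩ := existsUnique_nilpotent_sub_and_aeval_eq_zero hPB hPB'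
  have hcoe : ∀ (p : B[X]) (y : B), aeval (y : AdjoinRoot f) p = ((aeval y p : B) : AdjoinRoot f) :=
    fun p y => aeval_algebraMap_apply (AdjoinRoot f) y p
  have huniq := existsUnique_nilpotent_sub_and_aeval_eq_zero (R := B) (P := P)
    (x := (x₀ : AdjoinRoot f)) (by rw [hcoe]; exact hPB.map B.val)
    (by rw [hcoe]; exact hPB'.map B.val)
  have hrT : (r : AdjoinRoot f) = T := huniq.unique
    ⟨by simpa using hr1.map B.val, by rw [hcoe, hr2]; rfl⟩ ⟨n₀, by rw [hP, sub_self]⟩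
  have hTmem : T ∈ B := hrT ▸ r.2
  obtain ⟨q, hq⟩ : ∃ q : F[X], aeval (T ^ N) q = T := by
    have := Algebra.adjoin_singleton_eq_range_aeval F (T ^ N)
    have h : T ∈ (aeval (R := F) (T ^ N)).range := this ▸ hTmem
    simpa using h
  refine ⟨q, ?_⟩
  rw [← AdjoinRoot.mk_eq_zero, map_sub, hmk, AdjoinRoot.mk_X, hq, sub_self]

theorem LinearRecurrence.charPoly_coeff_zero {R : Type*} [CommRing R] (E : LinearRecurrence R)
    (h : 0 < E.order) : E.charPoly.coeff 0 = - E.coeffs ⟨0, h⟩ := by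
  simp only [LinearRecurrence.charPoly, Polynomial.coeff_sub, Polynomial.coeff_monomial,
    Polynomial.finsetSum_coeff]
  rw [if_neg h.ne', Finset.sum_eq_single ⟨0, h⟩]
  · simp
  · intro i _ hi
    rw [if_neg]
    exact fun h => hi (Fin.ext h)
  · simp

/-! ### The shift operator and non-vanishing on residue classes. -/

/-- The shift operator on two-sided sequences. -/
def seqShift (R M : Type*) [CommRing R] [AddCommGroup M] [Module R M] : Module.End R (ℤ → M) where
  toFun w n := w (n + 1)
  map_add' _ _ := rfl
  map_smul' _ _ := rfl

section seqShift

open Polynomial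

variable {R M : Type*} [CommRing R] [AddCommGroup M] [Module R M]

theorem seqShift_apply (w : ℤ → M) (n : ℤ) : seqShift R M w n = w (n + 1) := rfl

theorem seqShift_pow_apply (k : ℕ) (w : ℤ → M) (n : ℤ) :
    (seqShift R M ^ k) w n = w (n + k) := by
  induction k generalizing n with
  | zero => simp
  | succ k ih =>
    rw [pow_succ', Module.End.mul_apply, seqShift_apply, ih]
    congr 1; push_cast; ring

theorem aeval_seqShift_apply (g : R[X]) (w : ℤ → M) (n : ℤ) :
    aeval (seqShift R M) g w n = g.sum fun i c => c • w (n + i) := by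
  rw [aeval_eq_sum_range, sum_over_range _ (by simp)]
  simp [LinearMap.sum_apply, Finset.sum_apply, seqShift_pow_apply]

theorem aeval_seqShift_charPoly (E : LinearRecurrence R) {U : ℤ → M}
    (h : ∀ n : ℤ, U (n + (E.order : ℤ)) = ∑ i : Fin E.order, E.coeffs i • U (n + ((i : ℕ) : ℤ))) :
    aeval (seqShift R M) E.charPoly U = 0 := by
  funext n
  simp [LinearRecurrence.charPoly, aeval_monomial, LinearMap.sum_apply, Finset.sum_apply,
    seqShift_pow_apply, h, Algebra.algebraMap_eq_smul_one]

/-- A sequence annihilated by `f` that vanishes on a residue class modulo `N` is zero, provided that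
the `N`-th powers of the roots of `f` are distinct. -/
theorem eq_zero_of_eq_zero_on_residue_class {F : Type*} [Field F] [IsAlgClosed F] [CharZero F]
    {f : F[X]} (hf : f ≠ 0) (h0 : f.eval 0 ≠ 0) {N : ℕ} (hN : 0 < N)
    (hinj : ∀ x y : F, f.IsRoot x → f.IsRoot y → x ^ N = y ^ N → x = y)
    {w : ℤ → F} (hw : aeval (seqShift F F) f w = 0) {a : ℤ}
    (ha : ∀ t : ℤ, w (a + N * t) = 0) : w = 0 := by
  obtain ⟨q, c, hc⟩ := exists_dvd_comp_X_pow_sub_X hf h0 hN hinj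
  have hshift : seqShift F F w = aeval (seqShift F F ^ N) q w := by
    have h := congrArg (fun g => aeval (seqShift F F) g w) hc
    simp only [map_sub, aeval_comp, map_pow, aeval_X, mul_comm f c, map_mul,
      LinearMap.sub_apply, Module.End.mul_apply, hw, map_zero] at h
    exact (sub_eq_zero.1 h).symm
  -- The shift is a polynomial in its `N`-th power, so each value on the class of `b + 1` is a
  -- combination of values on the class of `b`.
  have hstep : ∀ b : ℤ, (∀ t : ℤ, w (b + N * t) = 0) → ∀ t : ℤ, w (b + 1 + N * t) = 0 := by
    intro b hb t
    have h := congrFun hshift (b + N * t)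
    rw [seqShift_apply] at h
    rw [add_right_comm, h, aeval_eq_sum_range]
    simp only [LinearMap.sum_apply, Finset.sum_apply, LinearMap.smul_apply, Pi.smul_apply,
      ← pow_mul, seqShift_pow_apply]
    refine Finset.sum_eq_zero fun i _ => ?_
    have := hb (t + i)
    rw [show b + N * t + ((N * i : ℕ) : ℤ) = b + N * (t + i) by push_cast; ring, this, smul_zero]
  have hall : ∀ k : ℕ, ∀ t : ℤ, w (a + k + N * t) = 0 := by
    intro k
    induction k with
    | zero => simpa using ha
    | succ k ih =>
      intro t
      have := hstep _ ih t
      rwa [add_assoc a, ← Nat.cast_succ] at this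
  funext n
  have hN' : (N : ℤ) ≠ 0 := by exact_mod_cast hN.ne'
  obtain ⟨k, hk⟩ := Int.eq_ofNat_of_zero_le (Int.emod_nonneg (n - a) hN')
  have := hall k ((n - a) / N)
  rwa [← hk, add_assoc, Int.emod_add_mul_ediv, add_sub_cancel] at this

end seqShift

/-- A non-degenerate linear recurrence sequence does not vanish on any residue class. -/
theorem IsNonDegenerateLRS.exists_ne_zero {K : Type*} [Field K] [CharZero K] {U : ℤ → K}
    (hU : IsNonDegenerateLRS U) (a : ℤ) {N : ℕ} (hN : 0 < N) :
    ∃ n : ℤ, n ≡ a [ZMOD (N : ℤ)] ∧ U n ≠ 0 := by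
  obtain ⟨hne, E, ⟨⟨⟨hpos, h0⟩, hrec⟩, -⟩, hnd⟩ := hU
  by_contra! hcon
  apply hne
  let F := AlgebraicClosure K
  have : CharZero F := charZero_of_injective_algebraMap (algebraMap K F).injective
  have hann := aeval_seqShift_charPoly (M := K) E (U := U) (by simpa using hrec)
  let f := E.charPoly.map (algebraMap K F)
  have hf0 : f.eval 0 ≠ 0 := by
    rw [← Polynomial.coeff_zero_eq_eval_zero, Polynomial.coeff_map, E.charPoly_coeff_zero hpos]
    simpa using h0
  have hf : f ≠ 0 := by rintro h; simp [h] at hf0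
  have hroot : ∀ x : F, f.IsRoot x → Polynomial.aeval x E.charPoly = 0 := by
    intro x hx
    rwa [← Polynomial.eval_map_algebraMap]
  have hz := eq_zero_of_eq_zero_on_residue_class (F := F) hf hf0 hN (w := fun n => algebraMap K F (U n))
    (a := a) ?_ ?_ ?_
  · funext n
    have := congrFun hz n
    simpa using this
  · intro x y hx hy hxy
    by_contra hne
    have hy0 : y ≠ 0 := by rintro rfl; exact hf0 hy
    exact hnd x y (hroot x hx) (hroot y hy) hne N hN (by
      rw [div_pow, hxy, div_self (pow_ne_zero _ hy0)])
  · funext n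
    have h := congrArg (algebraMap K F) (congrFun hann n)
    rw [aeval_seqShift_apply, Polynomial.sum_over_range _ (by simp)] at h
    rw [aeval_seqShift_apply, Polynomial.sum_over_range _ (by simp)]
    simpa [f, Polynomial.natDegree_map] using h
  · intro t
    rw [hcon (a + N * t) (by simp [Int.ModEq]), map_zero]

/-! ### Finite order of the indeterminate and divisibility of differences. -/

section FiniteOrder

open Polynomial

/-- Modulo a monic polynomial with invertible constant term over a ring with finite quotient
`R ⧸ (d)`, some positive power of the indeterminate is congruent to `1` modulo `d`. -/
theorem Polynomial.Monic.exists_X_pow_sub_one_eq {R : Type*} [CommRing R] {f : R[X]} (hf : f.Monic)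
    (h0 : IsUnit (f.coeff 0)) (d : R) [Finite (R ⧸ Ideal.span {d})] :
    ∃ Q : ℕ, 0 < Q ∧ ∃ b c : R[X], X ^ Q - 1 = C d * b + c * f := by
  let π := Ideal.Quotient.mk (Ideal.span {d})
  let g := f.map π
  have hg : g.Monic := hf.map π
  have := hg.finite_adjoinRoot
  have : Finite (AdjoinRoot g) := Module.finite_of_finite (R ⧸ Ideal.span {d})
  have hunit : IsUnit (AdjoinRoot.root g) := by
    have h1 : AdjoinRoot.mk g (g.divX * X + C (g.coeff 0)) = 0 := by
      rw [divX_mul_X_add, AdjoinRoot.mk_self]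
    rw [map_add, map_mul, AdjoinRoot.mk_X, AdjoinRoot.mk_C, add_eq_zero_iff_eq_neg] at h1
    refine isUnit_of_mul_isUnit_right (x := AdjoinRoot.mk g g.divX) ?_
    rw [h1, coeff_map]
    exact ((h0.map π).map _).neg
  obtain ⟨u, hu⟩ := hunit
  refine ⟨orderOf u, orderOf_pos u, ?_⟩
  have h2 : AdjoinRoot.mk g (X ^ orderOf u - 1) = 0 := by
    rw [map_sub, map_pow, AdjoinRoot.mk_X, map_one, ← hu, ← Units.val_pow_eq_pow_val,
      pow_orderOf_eq_one, Units.val_one, sub_self]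
  rw [AdjoinRoot.mk_eq_zero] at h2
  obtain ⟨c', hc'⟩ := h2
  obtain ⟨c, rfl⟩ := map_surjective π Ideal.Quotient.mk_surjective c'
  have h3 : (X ^ orderOf u - 1 - c * f : R[X]).map π = 0 := by
    simp only [Polynomial.map_sub, Polynomial.map_pow, map_X, Polynomial.map_one,
      Polynomial.map_mul, hc']
    rw [mul_comm, sub_self]
  have h4 : C d ∣ X ^ orderOf u - 1 - c * f := by
    rw [C_dvd_iff_dvd_coeff]
    intro i
    have := congrArg (fun p => p.coeff i) h3
    rw [coeff_map, coeff_zero, Ideal.Quotient.eq_zero_iff_mem] at this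
    exact Ideal.mem_span_singleton.1 this
  obtain ⟨b, hb⟩ := h4
  exact ⟨b, c, by rw [← hb]; ring⟩

theorem fwdDiff_iter_eq_aeval_seqShift {R M : Type*} [CommRing R] [AddCommGroup M] [Module R M]
    (Q j : ℕ) (U : ℤ → M) :
    (fwdDiff (Q : ℤ))^[j] U = aeval (seqShift R M) ((X ^ Q - 1 : R[X]) ^ j) U := by
  induction j with
  | zero => simp
  | succ j ih =>
    rw [Function.iterate_succ_apply', ih, pow_succ', map_mul, Module.End.mul_apply]
    funext n
    simp only [fwdDiff, map_sub, map_pow, aeval_X, map_one, LinearMap.sub_apply,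
      Module.End.one_apply, Pi.sub_apply, seqShift_pow_apply Q]

/-- Reducing `b ^ j` modulo `f` bounds its degree independently of `j`, so one finite window of `U`
controls all differences at a given point. -/
theorem fwdDiff_iter_eq_smul_aeval {R M : Type*} [CommRing R] [AddCommGroup M] [Module R M]
    {f b c : R[X]} {d : R} {Q : ℕ} (h : X ^ Q - 1 = C d * b + c * f)
    {U : ℤ → M} (hU : aeval (seqShift R M) f U = 0) (j : ℕ) :
    (fwdDiff (Q : ℤ))^[j] U = d ^ j • aeval (seqShift R M) (b ^ j %ₘ f) U := by
  obtain ⟨e, he⟩ : f ∣ (X ^ Q - 1) ^ j - C (d ^ j) * (b ^ j %ₘ f) := by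
    have h1 : f ∣ (X ^ Q - 1) ^ j - (C d * b) ^ j :=
      dvd_trans ⟨c, by rw [h]; ring⟩ (sub_dvd_pow_sub_pow _ _ _)
    have h2 : f ∣ C (d ^ j) * (b ^ j - b ^ j %ₘ f) :=
      Dvd.dvd.mul_left ⟨b ^ j /ₘ f, by
        rw [sub_eq_iff_eq_add, add_comm]; exact (modByMonic_add_div _ _).symm⟩ _
    have := dvd_add h1 h2
    rwa [mul_pow, ← C_pow, mul_sub, sub_add_sub_cancel] at this
  have := congrArg (fun g => aeval (seqShift R M) g U) he
  simp only [map_sub, LinearMap.sub_apply, map_mul, mul_comm f, Module.End.mul_apply, hU,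
    map_zero, sub_eq_zero, aeval_C, Module.algebraMap_end_apply] at this
  rw [fwdDiff_iter_eq_aeval_seqShift (R := R), this]

end FiniteOrder

/-! ### Decay of differences at a regular prime. -/

section NumberField

variable {K : Type*} [Field K] [NumberField K] (P : HeightOneSpectrum (𝓞 K))

theorem finite_quotient_span_valuation_integer (d : 𝓞 K) (hd : d ≠ 0)
    (x : (P.valuation K).integer) (hx : (x : K) = algebraMap (𝓞 K) K d) :
    Finite ((P.valuation K).integer ⧸ Ideal.span {x}) := by
  let φ : 𝓞 K →+* (P.valuation K).integer :=
    (algebraMap (𝓞 K) K).codRestrict _ fun r => P.valuation_le_one r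
  have hφd : φ d = x := Subtype.ext hx.symm
  have : Finite (𝓞 K ⧸ Ideal.span {d}) :=
    Ideal.finiteQuotientOfFreeOfNeBot _ (by simpa [Ideal.span_singleton_eq_bot] using hd)
  have hle : Ideal.span {d} ≤ (Ideal.span {x}).comap φ := by
    rw [Ideal.span_singleton_le_iff_mem, Ideal.mem_comap, hφd]
    exact Ideal.mem_span_singleton_self x
  refine Finite.of_surjective (Ideal.quotientMap _ φ hle) ?_
  intro y
  obtain ⟨y, rfl⟩ := Ideal.Quotient.mk_surjective y
  have hx0 : (x : K) ≠ 0 := by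
    rw [hx]
    exact (map_ne_zero_iff _ (FaithfulSMul.algebraMap_injective (𝓞 K) K)).2 hd
  have hv0 : P.valuation K (x : K) ≠ 0 := (Valuation.ne_zero_iff _).2 hx0
  -- Approximating `y` by a global integer more closely than `x` makes the residue map from `𝓞 K`
  -- surjective.
  obtain ⟨r, hr⟩ := P.exists_valuation_sub_lt_of_integer (K := K) y.2 (Units.mk0 _ hv0)
  refine ⟨Ideal.Quotient.mk _ r, ?_⟩
  rw [Ideal.quotientMap_mk, Ideal.Quotient.eq, Ideal.mem_span_singleton]
  refine ⟨⟨(algebraMap (𝓞 K) K r - y) / x, ?_⟩, ?_⟩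
  · rw [Valuation.mem_integer_iff, map_div₀]
    exact div_le_one_of_le₀ hr.le zero_le
  · apply Subtype.ext
    change algebraMap (𝓞 K) K r - y = x * ((algebraMap (𝓞 K) K r - y) / x)
    rw [mul_div_cancel₀ _ hx0]

/-- For a suitable step `Q`, the iterated differences of a linear recurrence sequence decay like
powers of `d` at a regular prime. -/
theorem IsRegularPrime.exists_valuation_fwdDiff_iter_le {E : LinearRecurrence K}
    {P : HeightOneSpectrum (𝓞 K)} (hP : IsRegularPrime P E) {U : ℤ → K}
    (hU : ∀ n : ℤ, U (n + (E.order : ℤ)) =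
      ∑ i : Fin E.order, E.coeffs i * U (n + ((i : ℕ) : ℤ)))
    {d : 𝓞 K} (hd : d ≠ 0) :
    ∃ Q : ℕ, 0 < Q ∧ ∀ n : ℤ, ∃ c : K, ∀ j : ℕ,
      P.valuation K ((fwdDiff (Q : ℤ))^[j] U n) ≤ P.valuation K (algebraMap (𝓞 K) K d ^ j * c) := by
  obtain ⟨hint, hpos, hunit⟩ := hP
  let R := (P.valuation K).integer
  let E' : LinearRecurrence R := ⟨E.order, fun i => ⟨E.coeffs i, hint i⟩⟩
  let x : R := ⟨algebraMap (𝓞 K) K d, P.valuation_le_one d⟩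
  have := finite_quotient_span_valuation_integer P d hd x rfl
  have h0 : IsUnit (E'.charPoly.coeff 0) := by
    rw [E'.charPoly_coeff_zero hpos, IsUnit.neg_iff,
      (Valuation.integer.integers (P.valuation K)).isUnit_iff_valuation_eq_one]
    exact hunit
  obtain ⟨Q, hQ, b, c, hbc⟩ := E'.charPoly_monic.exists_X_pow_sub_one_eq h0 x
  have hann := aeval_seqShift_charPoly (M := K) E' (U := U) hU
  refine ⟨Q, hQ, fun n => ?_⟩
  obtain ⟨c, hc⟩ := P.valuation_surjective K
    ((Finset.range (E'.charPoly.natDegree + 1)).sup fun i => P.valuation K (U (n + i)))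
  refine ⟨c, fun j => ?_⟩
  rw [fwdDiff_iter_eq_smul_aeval hbc hann, Pi.smul_apply]
  change P.valuation K ((x ^ j : R) * _) ≤ _
  rw [map_mul, map_mul]
  refine mul_le_mul' (le_of_eq rfl) ?_
  rw [aeval_seqShift_apply, Polynomial.sum_over_range' _ (by simp) (E'.charPoly.natDegree + 1)]
  · refine Valuation.map_sum_le _ fun i hi => ?_
    change P.valuation K ((_ : R) * _) ≤ _
    rw [map_mul, hc]
    refine (mul_le_of_le_one_left'
      ((b ^ j %ₘ E'.charPoly).coeff i).2).trans ?_
    exact Finset.le_sup (f := fun i : ℕ => P.valuation K (U (n + i))) hi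
  · exact Nat.lt_succ_of_le (Polynomial.natDegree_modByMonic_le _ E'.charPoly_monic)

end NumberField

/-! ### Newton series and analytic interpolation over ultrametric fields. -/

section Ultrametric

open Filter Topology

variable {L : Type*} [NontriviallyNormedField L] [IsUltrametricDist L] {p : ℕ}

theorem norm_natCast_eq_one_of_not_dvd (hp : p.Prime) (hlt : ‖(p : L)‖ < 1) {n : ℕ}
    (hn : ¬ p ∣ n) : ‖(n : L)‖ = 1 := by
  refine le_antisymm (IsUltrametricDist.norm_natCast_le_one L n) ?_
  by_contra! h
  have hcop : IsCoprime (n : ℤ) (p : ℤ) :=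
    Nat.isCoprime_iff_coprime.2 ((Nat.Prime.coprime_iff_not_dvd hp).2 hn).symm
  obtain ⟨x, y, hxy⟩ := hcop
  have h1 : (x : L) * n + y * p = 1 := by exact_mod_cast congrArg (Int.cast : ℤ → L) hxy
  have hx : ‖(x : L) * n‖ < 1 := by
    rw [norm_mul]
    exact mul_lt_one_of_nonneg_of_lt_one_right (IsUltrametricDist.norm_intCast_le_one L x)
      (norm_nonneg _) h
  have hy : ‖(y : L) * p‖ < 1 := by
    rw [norm_mul]
    exact mul_lt_one_of_nonneg_of_lt_one_right (IsUltrametricDist.norm_intCast_le_one L y)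
      (norm_nonneg _) hlt
  have := (IsUltrametricDist.norm_add_le_max ((x : L) * n) (y * p)).trans_lt (max_lt hx hy)
  rw [h1, norm_one] at this
  exact lt_irrefl _ this

/-- By Legendre's formula the exponent of `p` in `j!` is at most `j`. -/
theorem norm_pow_le_norm_factorial (hp : p.Prime) (hlt : ‖(p : L)‖ < 1) (j : ℕ) :
    ‖(p : L)‖ ^ j ≤ ‖((j.factorial : ℕ) : L)‖ := by
  have : Fact p.Prime := ⟨hp⟩
  obtain ⟨k, m, hm, hk⟩ := Nat.exists_eq_pow_mul_and_not_dvd j.factorial_ne_zero p hp.ne_one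
  have hk' : padicValNat p j.factorial = k := by
    rw [hk, padicValNat.mul (pow_ne_zero _ hp.ne_zero) (by rintro rfl; exact hm (dvd_zero p)),
      padicValNat.prime_pow, padicValNat.eq_zero_of_not_dvd hm, add_zero]
  have hkj : k ≤ j := by
    have h1 := sub_one_mul_padicValNat_factorial (p := p) j
    rw [hk'] at h1
    have h2 : 1 ≤ p - 1 := by have := hp.two_le; omega
    nlinarith [Nat.sub_le j (p.digits j).sum]
  rw [hk]
  push_cast
  rw [norm_mul, norm_pow, norm_natCast_eq_one_of_not_dvd hp hlt hm, mul_one]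
  exact pow_le_pow_of_le_one (norm_nonneg _) hlt.le hkj

variable [CompleteSpace L]

theorem hasSum_choose_smul_fwdDiff_iter {u : ℤ → L} {h : ℤ}
    (hlim : ∀ n, Tendsto (fun j : ℕ => (fwdDiff h)^[j] u n) atTop (𝓝 0)) (t n : ℤ) :
    HasSum (fun j : ℕ => ((Ring.choose t j : ℤ) : L) * (fwdDiff h)^[j] u n) (u (n + t * h)) := by
  have hsum : ∀ (t n : ℤ) (k l : ℕ),
      Summable fun j : ℕ => ((Ring.choose t (j + k) : ℤ) : L) * (fwdDiff h)^[j + l] u n := by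
    intro t n k l
    apply NonarchimedeanAddGroup.summable_of_tendsto_cofinite_zero
    rw [Nat.cofinite_eq_atTop]
    refine squeeze_zero_norm (fun j => ?_)
      (tendsto_zero_iff_norm_tendsto_zero.1 ((tendsto_add_atTop_iff_nat l).2 (hlim n)))
    rw [norm_mul]
    exact mul_le_of_le_one_left (norm_nonneg _) (IsUltrametricDist.norm_intCast_le_one L _)
  have hsum₀ : ∀ (t n : ℤ) (l : ℕ),
      Summable fun j : ℕ => ((Ring.choose t j : ℤ) : L) * (fwdDiff h)^[j + l] u n :=
    fun t n l => hsum t n 0 l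
  let G : ℤ → ℤ → L := fun t n => ∑' j : ℕ, ((Ring.choose t j : ℤ) : L) * (fwdDiff h)^[j] u n
  have hG0 : ∀ n, G 0 n = u n := by
    intro n
    simp only [G]
    rw [tsum_eq_single 0]
    · simp
    · intro j hj
      rw [Ring.choose_zero_pos ℤ (Nat.pos_of_ne_zero hj)]
      simp
  -- Pascal's rule; used in both directions, it reaches negative `t`, where the series need not
  -- terminate.
  have hGstep : ∀ t n, G (t + 1) n = G t (n + h) := by
    intro t n
    have e1 : G (t + 1) n = u n + ∑' j : ℕ, ((Ring.choose (t + 1) (j + 1) : ℤ) : L) *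
        (fwdDiff h)^[j + 1] u n := by
      have := (hsum (t + 1) n 0 0).tsum_eq_zero_add
      simpa [G] using this
    have e2 : ∑' j : ℕ, ((Ring.choose (t + 1) (j + 1) : ℤ) : L) * (fwdDiff h)^[j + 1] u n =
        (∑' j : ℕ, ((Ring.choose t j : ℤ) : L) * (fwdDiff h)^[j + 1] u n) +
        ∑' j : ℕ, ((Ring.choose t (j + 1) : ℤ) : L) * (fwdDiff h)^[j + 1] u n := by
      rw [← (hsum₀ t n 1).tsum_add (hsum t n 1 1)]
      refine tsum_congr fun j => ?_
      rw [Ring.choose_succ_succ]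
      push_cast
      ring_nf
    have e3 : G t n = u n + ∑' j : ℕ, ((Ring.choose t (j + 1) : ℤ) : L) *
        (fwdDiff h)^[j + 1] u n := by
      have := (hsum t n 0 0).tsum_eq_zero_add
      simpa [G] using this
    have e4 : G t (n + h) = G t n +
        ∑' j : ℕ, ((Ring.choose t j : ℤ) : L) * (fwdDiff h)^[j + 1] u n := by
      simp only [G]
      rw [← Summable.tsum_add (by simpa using hsum₀ t n 0) (hsum₀ t n 1)]
      refine tsum_congr fun j => ?_
      rw [Function.iterate_succ_apply', fwdDiff]
      ring
    rw [e1, e2, e4, e3]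
    ring
  have hG : ∀ t n, G t n = u (n + t * h) := by
    intro t
    induction t using Int.induction_on with
    | zero => intro n; simp [hG0]
    | succ t ih => intro n; rw [hGstep, ih]; congr 1; ring
    | pred t ih =>
      intro n
      have := hGstep (-(t : ℤ) - 1) (n - h)
      rw [sub_add_cancel, sub_add_cancel, ih] at this
      rw [← this]; congr 1; ring
  rw [← hG t n]
  exact (hsum t n 0 0).hasSum

/-- A series of polynomials `c j * P j` with `‖c j‖ → 0`, where `P j` has integer coefficients and
degree at most `j`, defines an analytic function at `0`. -/
theorem analyticAt_tsum_mul_aeval {c : ℕ → L} (hc : Tendsto c atTop (𝓝 0)) (P : ℕ → Polynomial ℤ)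
    (hP : ∀ j, (P j).natDegree ≤ j) :
    AnalyticAt L (fun z : L => ∑' j, c j * Polynomial.aeval z (P j)) 0 := by
  let b : ℕ → L := fun i => ∑' j, c j * ((P j).coeff i : L)
  refine ⟨FormalMultilinearSeries.ofScalars L b, ?_⟩
  rw [hasFPowerSeriesAt_iff]
  filter_upwards [Metric.closedBall_mem_nhds (0 : L) one_pos] with z hz
  rw [mem_closedBall_zero_iff] at hz
  simp only [FormalMultilinearSeries.coeff_ofScalars, zero_add, smul_eq_mul]
  -- Terms of norm at least `ε` have `i ≤ j < J`, so only finitely many exist; this justifies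
  -- exchanging the two sums.
  have key : ∀ w : L, ‖w‖ ≤ 1 →
      Summable fun x : ℕ × ℕ => c x.1 * ((P x.1).coeff x.2 : L) * w ^ x.2 := by
    intro w hw
    apply NonarchimedeanAddGroup.summable_of_tendsto_cofinite_zero
    rw [Metric.tendsto_nhds]
    intro ε hε
    obtain ⟨J, hJ⟩ := eventually_atTop.1 ((Metric.tendsto_nhds.1 hc) ε hε)
    rw [eventually_cofinite]
    refine (Set.finite_Iio J |>.prod (Set.finite_Iio J)).subset ?_
    rintro ⟨j, i⟩ hji
    simp only [Set.mem_ofPred_eq, dist_zero_right, not_lt] at hji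
    have hij : i ≤ j := by
      by_contra! h
      rw [Polynomial.coeff_eq_zero_of_natDegree_lt ((hP j).trans_lt h)] at hji
      simp at hji
      linarith
    have hj : j < J := by
      by_contra! h
      have h1 := hJ j h
      rw [dist_zero_right] at h1
      have h2 : ‖c j * ((P j).coeff i : L) * w ^ i‖ ≤ ‖c j‖ := by
        rw [norm_mul, norm_mul, norm_pow]
        exact mul_le_of_le_one_right (by positivity) (pow_le_one₀ (norm_nonneg _) hw) |>.trans
          (mul_le_of_le_one_right (norm_nonneg _) (IsUltrametricDist.norm_intCast_le_one L _))
      linarith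
    exact ⟨hj, hij.trans_lt hj⟩
  have hrow : ∀ j, HasSum (fun i => c j * ((P j).coeff i : L) * z ^ i)
      (c j * Polynomial.aeval z (P j)) := by
    intro j
    rw [Polynomial.aeval_eq_sum_range, Finset.mul_sum]
    have : ∀ i ∉ Finset.range ((P j).natDegree + 1), c j * ((P j).coeff i : L) * z ^ i = 0 := by
      intro i hi
      rw [Finset.mem_range, not_lt] at hi
      rw [Polynomial.coeff_eq_zero_of_natDegree_lt hi]
      simp
    have h1 := hasSum_sum_of_ne_finset_zero (L := .unconditional ℕ) this
    simpa [mul_assoc] using h1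
  have hs := (key z hz).hasSum
  have htot := hs.prod_fiberwise hrow
  have hcol : ∀ i, HasSum (fun j => c j * ((P j).coeff i : L) * z ^ i) (z ^ i * b i) := by
    intro i
    have h1 := (key 1 (by simp)).prod_symm.prod_factor i
    simp only [Prod.swap, one_pow, mul_one] at h1
    rw [mul_comm]
    exact h1.hasSum.mul_right _
  have := ((Equiv.prodComm ℕ ℕ).hasSum_iff.2 hs).prod_fiberwise hcol
  rwa [htot.tsum_eq]

theorem exists_analyticAt_eq_of_norm_fwdDiff_iter_le [CharZero L] (hp : p.Prime)
    (hlt : ‖(p : L)‖ < 1) {u : ℤ → L} {h : ℤ}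
    (hb : ∀ n, ∃ C : ℝ, ∀ j : ℕ, ‖(fwdDiff h)^[j] u n‖ ≤ (‖(p : L)‖ ^ 2) ^ j * C) (a : ℤ) :
    ∃ f : L → L, AnalyticAt L f 0 ∧ ∀ t : ℤ, f t = u (a + t * h) := by
  have hlim : ∀ n, Tendsto (fun j : ℕ => (fwdDiff h)^[j] u n) atTop (𝓝 0) := by
    intro n
    obtain ⟨C, hC⟩ := hb n
    refine squeeze_zero_norm hC ?_
    have := (tendsto_pow_atTop_nhds_zero_of_lt_one (by positivity)
      (pow_lt_one₀ (norm_nonneg (p : L)) hlt two_ne_zero)).mul_const C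
    simpa using this
  let c : ℕ → L := fun j => (fwdDiff h)^[j] u a / (j.factorial : L)
  have hp0 : 0 < ‖(p : L)‖ := norm_pos_iff.2 (Nat.cast_ne_zero.2 hp.ne_zero)
  have hc : Tendsto c atTop (𝓝 0) := by
    obtain ⟨C, hC⟩ := hb a
    refine squeeze_zero_norm (a := fun j => ‖(p : L)‖ ^ j * C) (fun j => ?_) ?_
    · have h1 := norm_pow_le_norm_factorial (L := L) hp hlt j
      have h2 : 0 < ‖((j.factorial : ℕ) : L)‖ := (pow_pos hp0 j).trans_le h1
      have hC0 : 0 ≤ C := by simpa using (norm_nonneg _).trans (hC 0)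
      rw [norm_div, div_le_iff₀ h2]
      calc _ ≤ (‖(p : L)‖ ^ 2) ^ j * C := hC j
        -- One factor `‖p‖ ^ j` pays for `j!`; the other makes the coefficients tend to zero.
        _ = ‖(p : L)‖ ^ j * C * ‖(p : L)‖ ^ j := by ring
        _ ≤ _ := by gcongr
    · simpa using (tendsto_pow_atTop_nhds_zero_of_lt_one hp0.le hlt).mul_const C
  refine ⟨_, analyticAt_tsum_mul_aeval hc (fun j => descPochhammer ℤ j)
    (fun j => (descPochhammer_natDegree ℤ j).le), fun t => ?_⟩
  rw [← (hasSum_choose_smul_fwdDiff_iter hlim t a).tsum_eq]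
  refine tsum_congr fun j => ?_
  have h1 := Ring.descPochhammer_eq_factorial_smul_choose t j
  rw [← Polynomial.eval_eq_smeval, nsmul_eq_mul] at h1
  have h2 : Polynomial.aeval (t : L) (descPochhammer ℤ j) =
      (((descPochhammer ℤ j).eval t : ℤ) : L) := by
    simpa using Polynomial.aeval_algebraMap_apply L t (descPochhammer ℤ j)
  have h3 : ((j.factorial : ℕ) : L) ≠ 0 := Nat.cast_ne_zero.2 j.factorial_ne_zero
  rw [h2, h1]
  simp only [c]
  push_cast
  field_simp

theorem exists_norm_eq_norm_pow_mul [CharZero L] (hp : p.Prime)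
    (hlt : ‖(p : L)‖ < 1) {u : ℤ → L} {h : ℕ}
    (hb : ∀ n, ∃ C : ℝ, ∀ j : ℕ, ‖(fwdDiff (h : ℤ))^[j] u n‖ ≤ (‖(p : L)‖ ^ 2) ^ j * C)
    {a : ℤ} (ha : u a = 0) (hne : ∀ r : ℕ, ∃ t : ℤ, u (a + (p ^ r * h : ℕ) * t) ≠ 0) :
    ∃ r s : ℕ, 0 < s ∧ u (a + (p ^ r * h : ℕ)) ≠ 0 ∧
      ∀ t : ℤ, ‖u (a + (p ^ r * h : ℕ) * t)‖ = ‖(t : L)‖ ^ s * ‖u (a + (p ^ r * h : ℕ))‖ := by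
  obtain ⟨f, hf, hfu⟩ := exists_analyticAt_eq_of_norm_fwdDiff_iter_le hp hlt hb a
  -- Every neighbourhood of `0` contains `p ^ r ℤ` for some `r`.
  have hnear : ∀ q : L → Prop, (∀ᶠ z in 𝓝 (0 : L), q z) →
      ∃ r : ℕ, ∀ t : ℤ, q ((p ^ r * t : ℤ) : L) := by
    intro q hq
    obtain ⟨ε, hε, hball⟩ := Metric.eventually_nhds_iff.1 hq
    obtain ⟨r, hr⟩ := exists_pow_lt_of_lt_one hε hlt
    refine ⟨r, fun t => hball ?_⟩
    push_cast
    rw [dist_zero_right, norm_mul, norm_pow]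
    exact (mul_le_of_le_one_right (by positivity)
      (IsUltrametricDist.norm_intCast_le_one L _)).trans_lt hr
  have hfu' : ∀ (r : ℕ) (t : ℤ), f ((p ^ r * t : ℤ) : L) = u (a + (p ^ r * h : ℕ) * t) := by
    intro r t
    rw [hfu]; congr 1; push_cast; ring
  have hnz : ¬ ∀ᶠ z in 𝓝 (0 : L), f z = 0 := by
    intro h0
    obtain ⟨r, hr⟩ := hnear _ h0
    obtain ⟨t, ht⟩ := hne r
    exact ht (by rw [← hfu', hr])
  obtain ⟨s, g, hg, hg0, hfg⟩ := hf.exists_eventuallyEq_pow_smul_nonzero_iff.2 hnz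
  have hgn : ∀ᶠ z in 𝓝 (0 : L), ‖g z‖ = ‖g 0‖ := by
    have := (Metric.tendsto_nhds.1 hg.continuousAt) ‖g 0‖ (norm_pos_iff.2 hg0)
    filter_upwards [this] with z hz
    rw [dist_eq_norm] at hz
    rw [sub_eq_add_neg, ← norm_neg (g 0)] at hz
    rw [← norm_neg (g 0)]
    exact IsUltrametricDist.norm_eq_of_add_norm_lt_max (hz.trans_le (le_max_right _ _))
  obtain ⟨r, hr⟩ := hnear _ (hfg.and hgn)
  have hs : 0 < s := by
    rcases Nat.eq_zero_or_pos s with rfl | hs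
    · have h1 := hfg.self_of_nhds
      have h2 := hfu 0
      simp only [Int.cast_zero, zero_mul, add_zero, ha] at h2
      simp only [h2, pow_zero, one_smul] at h1
      exact absurd h1.symm hg0
    · exact hs
  have hval : ∀ t : ℤ, ‖u (a + (p ^ r * h : ℕ) * t)‖ = ‖(t : L)‖ ^ s * ‖(p : L) ^ r‖ ^ s * ‖g 0‖ := by
    intro t
    obtain ⟨h1, h2⟩ := hr t
    rw [← hfu', h1, norm_smul, h2, norm_pow, sub_zero]
    push_cast
    rw [norm_mul, mul_pow]
    ring
  have hval1 : ‖u (a + (p ^ r * h : ℕ))‖ = ‖(p : L) ^ r‖ ^ s * ‖g 0‖ := by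
    simpa using hval 1
  refine ⟨r, s, hs, ?_, fun t => ?_⟩
  · rw [← norm_ne_zero_iff, hval1]
    have : (p : L) ≠ 0 := Nat.cast_ne_zero.2 hp.ne_zero
    exact mul_ne_zero (pow_ne_zero _ (norm_ne_zero_iff.2 (pow_ne_zero _ this)))
      (norm_ne_zero_iff.2 hg0)
  · rw [hval, hval1, mul_assoc]

end Ultrametric

/-! ### Transfer between `K` and its completion at `P`. -/

section NumberField

variable {K : Type*} [Field K] [NumberField K] (P : HeightOneSpectrum (𝓞 K))

theorem valuation_le_iff_norm_embedding_le (x y : K) :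
    P.valuation K x ≤ P.valuation K y ↔
      ‖NumberField.FinitePlace.embedding P x‖ ≤ ‖NumberField.FinitePlace.embedding P y‖ := by
  rw [NumberField.FinitePlace.norm_embedding', NumberField.FinitePlace.norm_embedding',
    NNReal.coe_le_coe]
  exact (WithZeroMulInt.toNNReal_strictMono
    (NumberField.HeightOneSpectrum.one_lt_absNorm_nnreal P)).le_iff_le.symm

theorem valuation_eq_iff_norm_embedding_eq (x y : K) :
    P.valuation K x = P.valuation K y ↔
      ‖NumberField.FinitePlace.embedding P x‖ = ‖NumberField.FinitePlace.embedding P y‖ := by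
  simp only [le_antisymm_iff, valuation_le_iff_norm_embedding_le]

theorem fwdDiff_iter_comp_ringHom {R S : Type*} [Ring R] [Ring S] (φ : R →+* S) (h : ℤ) (U : ℤ → R)
    (j : ℕ) (n : ℤ) : (fwdDiff h)^[j] (fun i => φ (U i)) n = φ ((fwdDiff h)^[j] U n) := by
  induction j generalizing n with
  | zero => rfl
  | succ j ih => simp only [Function.iterate_succ_apply', fwdDiff, ih, map_sub]

theorem IsRegularPrime.exists_valuation_eq {E : LinearRecurrence K}
    {P : HeightOneSpectrum (𝓞 K)} (hP : IsRegularPrime P E) {U : ℤ → K}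
    (hU : ∀ n : ℤ, U (n + (E.order : ℤ)) =
      ∑ i : Fin E.order, E.coeffs i * U (n + ((i : ℕ) : ℤ)))
    {a : ℤ} (ha : U a = 0)
    (hne : ∀ N : ℕ, 0 < N → ∃ n : ℤ, n ≡ a [ZMOD (N : ℤ)] ∧ U n ≠ 0)
    {p : ℕ} (hp : p.Prime) (hpP : P.valuation K (p : K) < 1) :
    ∃ Q s : ℕ, 0 < Q ∧ 0 < s ∧ U (a + Q) ≠ 0 ∧ ∀ t : ℤ,
      P.valuation K (U (a + Q * t)) = P.valuation K (t : K) ^ s * P.valuation K (U (a + Q)) := by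
  have hp0 : (p : K) ≠ 0 := Nat.cast_ne_zero.2 hp.ne_zero
  obtain ⟨h, hh, hb⟩ := hP.exists_valuation_fwdDiff_iter_le hU (d := (p : 𝓞 K) ^ 2)
    (pow_ne_zero _ (Nat.cast_ne_zero.2 hp.ne_zero))
  let φ := NumberField.FinitePlace.embedding (K := K) P
  have hlt : ‖(p : P.adicCompletion K)‖ < 1 := by
    have h1 := (valuation_le_iff_norm_embedding_le P 1 (p : K)).not
    rw [(P.valuation K).map_one, not_le, map_one, norm_one, not_le, map_natCast φ] at h1
    exact h1.1 hpP
  have hpL : (p : P.adicCompletion K) ≠ 0 := by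
    rw [← map_natCast φ]; exact (map_ne_zero φ).2 hp0
  let _ : NontriviallyNormedField (P.adicCompletion K) :=
    .ofNormNeOne ⟨p, hpL, hlt.ne⟩
  have : IsUltrametricDist (P.adicCompletion K) := inferInstance
  have : CharZero (P.adicCompletion K) := charZero_of_injective_ringHom φ.injective
  have hbound : ∀ n, ∃ C : ℝ, ∀ j : ℕ, ‖(fwdDiff (h : ℤ))^[j] (fun n => φ (U n)) n‖ ≤
      (‖(p : P.adicCompletion K)‖ ^ 2) ^ j * C := by
    intro n
    obtain ⟨c, hc⟩ := hb n
    refine ⟨‖φ c‖, fun j => ?_⟩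
    have := (valuation_le_iff_norm_embedding_le P _ _).1 (hc j)
    rw [fwdDiff_iter_comp_ringHom]
    simpa using this
  have hnonzero : ∀ r : ℕ, ∃ t : ℤ, φ (U (a + (p ^ r * h : ℕ) * t)) ≠ 0 := by
    intro r
    obtain ⟨n, hn, hUn⟩ := hne (p ^ r * h) (Nat.mul_pos (pow_pos hp.pos r) hh)
    obtain ⟨t, ht⟩ := hn.symm.dvd
    refine ⟨t, (map_ne_zero φ).2 ?_⟩
    rwa [← ht, add_sub_cancel]
  obtain ⟨r, s, hs, h0, heq⟩ := exists_norm_eq_norm_pow_mul hp hlt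
    (u := fun n => φ (U n)) hbound (by rw [ha, map_zero]) hnonzero
  refine ⟨p ^ r * h, s, Nat.mul_pos (pow_pos hp.pos r) hh, hs, (map_ne_zero φ).1 h0, fun t => ?_⟩
  rw [← map_pow, ← map_mul, valuation_eq_iff_norm_embedding_eq, map_mul, map_pow, map_intCast,
    norm_mul, norm_pow]
  exact heq t

theorem valuation_intCast_eq_pow {p : ℕ} (hp : p.Prime)
    (hPp : P.asIdeal.LiesOver (Ideal.span {(p : ℤ)})) {t : ℤ} (ht : t ≠ 0) :
    P.valuation K (t : K) = P.valuation K (p : K) ^ padicValInt p t := by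
  have : Fact p.Prime := ⟨hp⟩
  obtain ⟨m, hm⟩ := padicValInt_dvd (p := p) t
  have hpm : ¬ (p : ℤ) ∣ m := by
    rintro ⟨k, rfl⟩
    have h1 : (p : ℤ) ^ (padicValInt p t + 1) ∣ t := ⟨k, by rw [pow_succ, mul_assoc, ← hm]⟩
    rw [padicValInt_dvd_iff] at h1
    rcases h1 with h1 | h1
    · exact ht h1
    · omega
  -- The cofactor `m` is prime to `p`, and `P` meets `ℤ` exactly in `(p)`.
  have hv : P.valuation K (m : K) = 1 := by
    have h1 : (m : K) = algebraMap (𝓞 K) K (m : 𝓞 K) := by simp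
    rw [h1, P.valuation_eq_one_iff_notMem]
    intro h2
    apply hpm
    rw [← Ideal.mem_span_singleton, hPp.over, Ideal.mem_under]
    simpa using h2
  conv_lhs => rw [hm]
  push_cast
  rw [map_mul, hv, mul_one, map_pow]

theorem valuation_natCast_lt_one_of_liesOver {p : ℕ}
    (hPp : P.asIdeal.LiesOver (Ideal.span {(p : ℤ)})) : P.valuation K (p : K) < 1 := by
  have h1 : (p : K) = algebraMap (𝓞 K) K (p : 𝓞 K) := by simp
  rw [h1, P.valuation_lt_one_iff_mem]
  have h2 : (p : ℤ) ∈ P.asIdeal.under ℤ := hPp.over ▸ Ideal.mem_span_singleton_self _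
  rw [Ideal.mem_under] at h2
  simpa using h2

end NumberField

/-! ### Conversion to additive valuations. -/

theorem mainTheorem4 {K : Type*} [Field K] [NumberField K]
    (U : ℤ → K) (E : LinearRecurrence K) (hU : IsLRSWith E U)
    (a : ℤ) (ha : U a = 0)
    (hnd : IsNonDegenerateLRS U ∨
      ∀ N : ℕ, 0 < N → ∃ n : ℤ, n ≡ a [ZMOD (N : ℤ)] ∧ U n ≠ 0)
    (P : HeightOneSpectrum (𝓞 K)) (hP : IsRegularPrime P E)
    (p : ℕ) (hp : p.Prime) (hPp : P.asIdeal.LiesOver (Ideal.span {(p : ℤ)})) :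
    ∃ (Q κ : ℕ) (τ : ℤ), 0 < Q ∧ 0 < κ ∧
      ∀ n : ℤ, n ≡ a [ZMOD (Q : ℤ)] →
        primeOrd P (U n) = κ • padicOrd p (n - a) + (τ : WithTop ℤ) := by
  have hne : ∀ N : ℕ, 0 < N → ∃ n : ℤ, n ≡ a [ZMOD (N : ℤ)] ∧ U n ≠ 0 :=
    hnd.elim (fun h N hN => h.exists_ne_zero a hN) id
  have : Fact p.Prime := ⟨hp⟩
  have hlt := valuation_natCast_lt_one_of_liesOver P hPp
  obtain ⟨Q, s, hQ, hs, hUQ, hval⟩ := hP.exists_valuation_eq hU.2 ha hne hp hlt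
  have hvp0 : P.valuation K (p : K) ≠ 0 :=
    (Valuation.ne_zero_iff _).2 (Nat.cast_ne_zero.2 hp.ne_zero)
  have hvU0 : P.valuation K (U (a + Q)) ≠ 0 := (Valuation.ne_zero_iff _).2 hUQ
  have hlog : WithZero.log (P.valuation K (p : K)) < 0 := by
    rw [← WithZero.log_one]
    exact (WithZero.log_lt_log hvp0 one_ne_zero).2 hlt
  -- Here `e` is the ramification index of `P` over `p`.
  obtain ⟨e, he⟩ := Int.eq_ofNat_of_zero_le (neg_nonneg.2 hlog.le)
  have he0 : 0 < e := by omega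
  -- The last term of `τ` compensates for `n - a = Q * t`, as the formula in hand involves `ν_p(t)`.
  refine ⟨Q, s * e, -WithZero.log (P.valuation K (U (a + Q))) - (s * e : ℕ) * padicValInt p Q,
    hQ, Nat.mul_pos hs he0, fun n hn => ?_⟩
  obtain ⟨t, ht⟩ := hn.symm.dvd
  obtain rfl : n = a + Q * t := by rw [← ht]; ring
  rcases eq_or_ne t 0 with rfl | ht0
  · have hκ : s * e ≠ 0 := (Nat.mul_pos hs he0).ne'
    obtain ⟨k, hk⟩ := Nat.exists_eq_succ_of_ne_zero hκ
    simp [primeOrd, padicOrd, ha, hk, succ_nsmul]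
  · have hQ0 : (Q : ℤ) ≠ 0 := by exact_mod_cast hQ.ne'
    have hvt := valuation_intCast_eq_pow P hp hPp ht0
    have hv := hval t
    rw [hvt] at hv
    have hU0 : U (a + Q * t) ≠ 0 := by
      rw [← Valuation.ne_zero_iff (P.valuation K), hv]
      exact mul_ne_zero (pow_ne_zero _ (pow_ne_zero _ hvp0)) hvU0
    have hlv : -WithZero.log (P.valuation K (U (a + Q * t))) =
        s * (padicValInt p t * e) - WithZero.log (P.valuation K (U (a + Q))) := by
      rw [hv, WithZero.log_mul (pow_ne_zero _ (pow_ne_zero _ hvp0)) hvU0, WithZero.log_pow,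
        WithZero.log_pow, nsmul_eq_mul, nsmul_eq_mul, ← he]
      ring
    rw [primeOrd, if_neg hU0, padicOrd, add_sub_cancel_left, if_neg (mul_ne_zero hQ0 ht0),
      padicValInt.mul hQ0 ht0, hlv, ← WithTop.coe_nsmul, ← WithTop.coe_add]
    congr 1
    push_cast
    rw [nsmul_eq_mul]
    push_cast
    ring
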